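/- **Setting.** Let $\mathcal K\subseteq\mathbb R^d$ be compact and let $\nu$ be a locally finite Borel measure on $\mathbb R^d$, written $d\xi$ in integrals (for instance the Lebesgue measure, or a counting measure if $\mathcal K$ is finite). Let $\Xi$ be a random variable with values in $\mathcal K$ whose law is absolutely continuous with respect to $\nu$, with density $f_\Xi$. Write $L_2=L_2(\mathcal K,\nu)$ and $L_2^+=\{\lambda\in L_2:\lambda\ge 0 \text{ a.e.}\}$. Let $J:\mathbb R^p\to\mathbb R$ be strongly convex and continuously differentiable. For $i=1,\dots,m$ let $g_i:\mathbb R^p\times\mathcal K\to\mathbb R$ be continuously differentiable, such that $g_i(z,\cdot)\in L_2$ is $L_i$-Lipschitz for the $\ell_\infty$-norm for every $z$, and $g_i(\cdot,\xi)$ is convex and coercive for every $\xi\in\mathcal K$. Assume that some $\bar z$ satisfies $g_i(\bar z,\xi)<0$ for all $i$ and all $\xi\in\mathcal K$. Let $h:\mathbb R^m\to\mathbb R$ be twice differentiable and strongly convex. For $s\in L_2(\mathcal K,\nu;\mathbb R^m)$ let $$P^\star(s)=\inf\{J(z): z\in\mathbb R^p,\ g_i(z,\xi)\le s_i(\xi)\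 \text{for all } i \text{ and all } \xi\in\mathcal K\},$$ with $P^\star(s)=+\infty$ if there is no such $z$. Let $$\mathcal L(z,\lambda,s)=J(z)+\int_{\mathcal K}\lambda(\xi)^T[g(z,\xi)-s(\xi)]\,d\xi .$$ A *dual solution for $s$* is a maximizer of $\lambda\mapsto\inf_{z}\mathcal L(z,\lambda,s)$ over all $\lambda$ with $\lambda_i\in L_2^+$, $i=1,\dots,m$. Slacks are functions $s:\mathcal K\to\mathbb R^m_+$ with components in $L_2$. Slacks $s^\star$ are a *resilient equilibrium* if $P^\star$ has at $s^\star$ the gradient $\xi\mapsto-\nabla h(s^\star(\xi))f_\Xi(\xi)$; this means that this function is in $L_2$ and that $$\frac{d}{dt}\Big|_{t=0}P^\star(s^\star+tv)=-\int_{\mathcal K}\nabla h(s^\star(\xi))^Tv(\xi)\,f_\Xi(\xi)\,d\xi$$ for every bounded measurable $v:\mathcal K\to\mathbb R^m$. They are a *generalized resilient equilibrium* if this function is in $L_2$ and is a subgradient of the convex function $P^\star$ on $L_2$ at $s^\star$. **Claim.** The map $\nabla h:\mathbb R^m\to\mathbb R^m$ is a bijection, and the following hold. 1. If $s^\star$ is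 a resilient equilibrium, then every dual solution $\lambda^\star(s^\star)$ for $s^\star$ satisfies $$s^\star(\xi)=(\nabla h)^{-1}\!\left[\frac{\lambda^\star(s^\star)(\xi)}{f_\Xi(\xi)}\right]\quad\text{for a.e. } \xi\in\mathcal K \text{ with } f_\Xi(\xi)>0 .$$ 2. If $s^\star$ is a generalized resilient equilibrium, then there is a dual solution $\lambda^\star(s^\star)$ for $s^\star$ that satisfies the same relation. -/

import Mathlib

open MeasureTheory Set Filter

noncomputable section

namespace Resilient

/-- Euclidean space of dimension `n`. -/
abbrev Vec (n : ℕ) : Type := EuclideanSpace ℝ (Fin n)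

variable {p d m : ℕ}

/-- Standing assumptions on the control performance `J` and the requirements `g i z ξ`, for `z` in
`ℝᵖ` and `ξ` in the set `K` of disturbances; `ν` is the measure written `dξ` in the integrals. -/
structure StandingAssumptions (J : Vec p → ℝ) (g : Fin m → Vec p → Vec d → ℝ) (K : Set (Vec d))
    (ν : Measure (Vec d)) : Prop where
  strongly_convex : ∃ c : ℝ, 0 < c ∧ StrongConvexOn univ c J
  contDiff : ContDiff ℝ 1 J
  memLp : ∀ i z, MemLp (g i z) 2 (ν.restrict K)
  lipschitz : ∀ i, ∃ L : ℝ, ∀ z, ∀ ξ ∈ K, ∀ ξ' ∈ K,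
    |g i z ξ - g i z ξ'| ≤ L * ‖WithLp.ofLp (ξ - ξ')‖
  coercive : ∀ i, ∀ ξ ∈ K, Tendsto (fun z => g i z ξ) (cocompact (Vec p)) atTop
  convex : ∀ i, ∀ ξ ∈ K, ConvexOn ℝ univ (fun z => g i z ξ)
  contDiffOn : ∀ i, ContDiffOn ℝ 1 (fun q : Vec p × Vec d => g i q.1 q.2) (univ ×ˢ K)

/-- Slater's condition. -/
def Slater (g : Fin m → Vec p → Vec d → ℝ) (K : Set (Vec d)) : Prop :=
  ∃ z : Vec p, ∀ ξ ∈ K, ∀ i, g i z ξ < 0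

/-- The violation cost is twice differentiable and strongly convex. -/
structure IsViolationCost (h : Vec m → ℝ) : Prop where
  differentiable : Differentiable ℝ h
  differentiable_gradient : Differentiable ℝ (gradient h)
  strongly_convex : ∃ c : ℝ, 0 < c ∧ StrongConvexOn univ c h

/-- Slacks: nonnegative square-integrable vector functions on `K`. -/
def IsSlack (K : Set (Vec d)) (ν : Measure (Vec d)) (s : Vec d → Vec m) : Prop :=
  MemLp s 2 (ν.restrict K) ∧ ∀ ξ ∈ K, ∀ i, 0 ≤ s ξ i

/-- The feasible set of the problem `min J z` subject to `g z ξ ≤ s ξ` for all `ξ ∈ K`. -/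
def feasible (g : Fin m → Vec p → Vec d → ℝ) (K : Set (Vec d)) (s : Vec d → Vec m) :
    Set (Vec p) :=
  {z | ∀ ξ ∈ K, ∀ i, g i z ξ ≤ s ξ i}

/-- The optimal value of that problem, as a function of `s` (used where the problem is feasible). -/
def value (J : Vec p → ℝ) (g : Fin m → Vec p → Vec d → ℝ) (K : Set (Vec d))
    (s : Vec d → Vec m) : ℝ :=
  sInf (J '' feasible g K s)

/-- The Lagrangian of that problem. -/
def lagrangian (J : Vec p → ℝ) (g : Fin m → Vec p → Vec d → ℝ) (K : Set (Vec d))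
    (ν : Measure (Vec d)) (z : Vec p) (lam s : Vec d → Vec m) : ℝ :=
  J z + ∫ ξ in K, ∑ i, lam ξ i * (g i z ξ - s ξ i) ∂ν

/-- The dual function: the infimum of the Lagrangian over the decision variable. -/
def dualFunction (J : Vec p → ℝ) (g : Fin m → Vec p → Vec d → ℝ) (K : Set (Vec d))
    (ν : Measure (Vec d)) (lam s : Vec d → Vec m) : EReal :=
  ⨅ z : Vec p, (lagrangian J g K ν z lam s : EReal)

/-- Dual variables: square-integrable and almost everywhere nonnegative. -/
def IsDualVariable (K : Set (Vec d)) (ν : Measure (Vec d)) (lam : Vec d → Vec m) : Prop :=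
  MemLp lam 2 (ν.restrict K) ∧ ∀ᵐ ξ ∂(ν.restrict K), ∀ i, 0 ≤ lam ξ i

/-- `lam` solves the dual problem with slacks `s`. -/
def IsDualSolution (J : Vec p → ℝ) (g : Fin m → Vec p → Vec d → ℝ) (K : Set (Vec d))
    (ν : Measure (Vec d)) (s lam : Vec d → Vec m) : Prop :=
  IsDualVariable K ν lam ∧
    ∀ mu : Vec d → Vec m, IsDualVariable K ν mu →
      dualFunction J g K ν mu s ≤ dualFunction J g K ν lam s

/-- `G` is the gradient of the optimal value at the slacks `s`: it is square-integrable and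
represents the (two-sided) directional derivatives of the optimal value along all bounded
measurable directions. -/
def HasValueGradient (J : Vec p → ℝ) (g : Fin m → Vec p → Vec d → ℝ) (K : Set (Vec d))
    (ν : Measure (Vec d)) (s G : Vec d → Vec m) : Prop :=
  MemLp G 2 (ν.restrict K) ∧
    ∀ v : Vec d → Vec m, AEStronglyMeasurable v (ν.restrict K) →
      (∃ C : ℝ, ∀ ξ ∈ K, ‖v ξ‖ ≤ C) →
      HasDerivAt (fun t : ℝ => value J g K (s + t • v)) (∫ ξ in K, inner ℝ (G ξ) (v ξ) ∂ν) 0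

/-- `G` is a subgradient at `s`, with respect to the `L²` pairing, of the optimal value, which is a
convex function on `L²` with the value `+∞` where the problem is infeasible. -/
def HasValueSubgradient (J : Vec p → ℝ) (g : Fin m → Vec p → Vec d → ℝ) (K : Set (Vec d))
    (ν : Measure (Vec d)) (s G : Vec d → Vec m) : Prop :=
  MemLp G 2 (ν.restrict K) ∧
    ∀ s' : Vec d → Vec m, MemLp s' 2 (ν.restrict K) → (feasible g K s').Nonempty →
      value J g K s + ∫ ξ in K, inner ℝ (G ξ) (s' ξ - s ξ) ∂ν ≤ value J g K s'

/-- The density of the law `P` of the disturbance with respect to `ν`. -/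
def density (P ν : Measure (Vec d)) (ξ : Vec d) : ℝ := (P.rnDeriv ν ξ).toReal

/-- The resilient equilibrium: the gradient of the optimal value at `s` is `-∇h(s(ξ)) f(ξ)`. -/
def IsResilientEquilibrium (J : Vec p → ℝ) (g : Fin m → Vec p → Vec d → ℝ) (K : Set (Vec d))
    (ν P : Measure (Vec d)) (h : Vec m → ℝ) (s : Vec d → Vec m) : Prop :=
  IsSlack K ν s ∧ HasValueGradient J g K ν s (fun ξ => -(density P ν ξ • gradient h (s ξ)))

/-- The resilient equilibrium where the optimal value need not be differentiable: `-∇h(s(ξ)) f(ξ)`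
is one of its subgradients at `s`. -/
def IsGeneralizedResilientEquilibrium (J : Vec p → ℝ) (g : Fin m → Vec p → Vec d → ℝ)
    (K : Set (Vec d)) (ν P : Measure (Vec d)) (h : Vec m → ℝ) (s : Vec d → Vec m) : Prop :=
  IsSlack K ν s ∧ HasValueSubgradient J g K ν s (fun ξ => -(density P ν ξ • gradient h (s ξ)))

/-- The fixed-point relation `s = (∇h)⁻¹[lam / f]`, almost everywhere where the quotient makes
sense. -/
def FixedPointRelation (K : Set (Vec d)) (ν P : Measure (Vec d)) (h : Vec m → ℝ)
    (s lam : Vec d → Vec m) : Prop :=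
  ∀ᵐ ξ ∂(ν.restrict K), 0 < density P ν ξ →
    s ξ = Function.invFun (gradient h) ((density P ν ξ)⁻¹ • lam ξ)

end Resilient

end

/-! Either kind of equilibrium gives the subgradient inequality for the optimal value, with `G = -f
∇h(s)`, along bounded directions. Then `-G` is a Lagrange multiplier. It is nonnegative because
larger slacks cannot raise the optimum. Every `z` is feasible for the slacks `s + (g z - s)`, so the
inequality in the direction `g z - s` bounds the Lagrangian at `-G` below by the optimal value
(`HasBoundedSubgradient.value_le_lagrangian_neg`). By weak duality `-G` is a dual solution without
gap. If `G` is a gradient, every dual solution `lam` supports the optimal value at `s` with slope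
`-lam`, so differentiability forces `lam = -G` a.e.
(`HasValueGradient.ae_eq_neg_of_isDualSolution`). Dividing `lam = f ∇h(s)` by `f` and inverting `∇h`
gives the relation. -/

open MeasureTheory Set Filter Topology

namespace Resilient

/-! ### Strongly convex functions and their gradients -/

section StrongConvexity

/-- A derivative at `0` is bounded by the slope of any linear majorant on `(0, 1)`. -/
theorem hasDerivAt_le_of_forall_le {φ : ℝ → ℝ} {φ' a : ℝ} (hφ : HasDerivAt φ φ' 0)
    (hle : ∀ t ∈ Ioo (0 : ℝ) 1, φ t ≤ φ 0 + t * a) : φ' ≤ a := by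
  have h1 : Tendsto (slope φ 0) (𝓝[>] 0) (𝓝 φ') :=
    (hasDerivAt_iff_tendsto_slope.1 hφ).mono_left
      (nhdsWithin_mono _ fun x hx => ne_of_gt hx)
  refine le_of_tendsto h1 ?_
  filter_upwards [Ioo_mem_nhdsGT (zero_lt_one' ℝ)] with t ht
  rw [slope_def_field, div_le_iff₀ (by linarith [ht.1])]
  linarith [hle t ht]

variable {E : Type*} [NormedAddCommGroup E] [InnerProductSpace ℝ E] [CompleteSpace E]

theorem hasDerivAt_comp_add_smul {f : E → ℝ} (hf : Differentiable ℝ f) (x w : E) :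
    HasDerivAt (fun t : ℝ => f (x + t • w)) (inner ℝ (gradient f x) w) 0 := by
  have hl : HasDerivAt (fun t : ℝ => x + t • w) w 0 := by
    simpa using ((hasDerivAt_id (0 : ℝ)).smul_const w).const_add x
  have hg : HasFDerivAt f (InnerProductSpace.toDual ℝ E (gradient f x)) (x + (0 : ℝ) • w) := by
    simpa using (hf x).hasGradientAt.hasFDerivAt
  have := hg.comp_hasDerivAt (0 : ℝ) hl
  rwa [InnerProductSpace.toDual_apply_apply] at this

/-- First-order characterization of strong convexity. -/
theorem StrongConvexOn.add_inner_gradient_le {f : E → ℝ} {c : ℝ} (hc : StrongConvexOn univ c f)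
    (hf : Differentiable ℝ f) (x y : E) :
    f x + inner ℝ (gradient f x) (y - x) + c / 2 * ‖y - x‖ ^ 2 ≤ f y := by
  -- The strong convexity defect is moved to the left side; its slope at `0` is the quadratic term.
  have hq : HasDerivAt (fun t : ℝ => t * (1 - t) * (c / 2 * ‖y - x‖ ^ 2))
      (c / 2 * ‖y - x‖ ^ 2) 0 := by
    have := (((hasDerivAt_id (0 : ℝ)).mul ((hasDerivAt_id (0 : ℝ)).const_sub 1)).mul_const
      (c / 2 * ‖y - x‖ ^ 2))
    simpa using this
  have key := hasDerivAt_le_of_forall_le (a := f y - f x)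
    ((hasDerivAt_comp_add_smul hf x (y - x)).add hq) ?_
  · linarith
  · intro t ht
    have h1 := hc.2 (mem_univ x) (mem_univ y) (sub_nonneg.2 ht.2.le) ht.1.le
      (sub_add_cancel 1 t)
    have h2 : (1 - t) • x + t • y = x + t • (y - x) := by module
    rw [h2, norm_sub_rev] at h1
    simp only [smul_eq_mul] at h1
    simp only [Pi.add_apply, zero_smul, add_zero, zero_mul]
    nlinarith [h1]

/-- Complete the square in the first-order bound at `0`. This makes the real `sInf` in `value` a
genuine infimum on nonempty feasible sets. -/
theorem StrongConvexOn.exists_forall_ge {f : E → ℝ} {c : ℝ} (hc : StrongConvexOn univ c f)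
    (hf : Differentiable ℝ f) (hc0 : 0 < c) : ∃ b, ∀ x, b ≤ f x := by
  refine ⟨f 0 - ‖gradient f 0‖ ^ 2 / (2 * c), fun x => ?_⟩
  have h1 := StrongConvexOn.add_inner_gradient_le hc hf 0 x
  have h2 := neg_le_of_abs_le (abs_real_inner_le_norm (gradient f 0) x)
  rw [sub_zero] at h1
  have h3 : ‖gradient f 0‖ ^ 2 / (2 * c) - ‖gradient f 0‖ * ‖x‖ + c / 2 * ‖x‖ ^ 2
      = (‖gradient f 0‖ - c * ‖x‖) ^ 2 / (2 * c) := by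
    field_simp
    ring
  have h4 : 0 ≤ (‖gradient f 0‖ - c * ‖x‖) ^ 2 / (2 * c) := by positivity
  linarith

/-- Adding the first-order bounds at `x` and at `y` cancels the gradient terms and leaves `c * ‖y -
x‖ ^ 2 ≤ 0`. -/
theorem StrongConvexOn.injective_gradient {f : E → ℝ} {c : ℝ} (hc : StrongConvexOn univ c f)
    (hf : Differentiable ℝ f) (hc0 : 0 < c) : Function.Injective (gradient f) := by
  intro x y hxy
  have h1 := StrongConvexOn.add_inner_gradient_le hc hf x y
  have h2 := StrongConvexOn.add_inner_gradient_le hc hf y x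
  rw [← hxy, norm_sub_rev, ← neg_sub y x, inner_neg_right] at h2
  have h3 : ‖y - x‖ ^ 2 ≤ 0 := by
    have : c * ‖y - x‖ ^ 2 ≤ 0 := by linarith
    nlinarith
  have h4 : ‖y - x‖ = 0 := by nlinarith [norm_nonneg (y - x)]
  exact (sub_eq_zero.1 (norm_eq_zero.1 h4)).symm

/-- Quadratic growth makes `f - ⟨y, ·⟩` coercive, so it has a minimizer, where the gradient of `f`
is `y`. -/
theorem StrongConvexOn.surjective_gradient [ProperSpace E] {f : E → ℝ} {c : ℝ}
    (hc : StrongConvexOn univ c f) (hf : Differentiable ℝ f) (hc0 : 0 < c) :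
    Function.Surjective (gradient f) := by
  intro y
  have hlow : ∀ x : E, f 0 + ‖x‖ * (c / 2 * ‖x‖ - ‖gradient f 0 - y‖) ≤ f x - inner ℝ y x := by
    intro x
    have h1 := StrongConvexOn.add_inner_gradient_le hc hf 0 x
    have h2 := neg_le_of_abs_le (abs_real_inner_le_norm (gradient f 0 - y) x)
    rw [sub_zero] at h1
    rw [inner_sub_left] at h2
    nlinarith
  have hlim : Tendsto (fun x : E => f x - inner ℝ y x) (cocompact E) atTop := by
    refine tendsto_atTop_mono hlow (tendsto_atTop_add_const_left _ _ ?_)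
    have hn := tendsto_norm_cocompact_atTop (E := E)
    refine hn.atTop_mul_atTop₀ ?_
    simp only [sub_eq_add_neg]
    exact tendsto_atTop_add_const_right _ _ (hn.const_mul_atTop (by positivity))
  have hcont : Continuous fun x : E => f x - inner ℝ y x :=
    hf.continuous.sub (by fun_prop)
  obtain ⟨x, hx⟩ := hcont.exists_forall_le hlim
  refine ⟨x, ?_⟩
  have hmin : ∀ w : E, inner ℝ (gradient f x) w - inner ℝ y w = 0 := by
    intro w
    have hd : HasDerivAt (fun t : ℝ => f (x + t • w) - inner ℝ y (x + t • w))
        (inner ℝ (gradient f x) w - inner ℝ y w) 0 := by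
      have hl : HasDerivAt (fun t : ℝ => (inner ℝ y (x + t • w) : ℝ)) (inner ℝ y w) 0 := by
        have := ((hasDerivAt_id (0 : ℝ)).mul_const (inner ℝ y w : ℝ)).const_add
          (inner ℝ y x : ℝ)
        simpa [inner_add_right, inner_smul_right] using this
      exact (hasDerivAt_comp_add_smul hf x w).sub hl
    refine IsLocalMin.hasDerivAt_eq_zero (Eventually.of_forall fun t => ?_) hd
    simpa using hx (x + t • w)
  have := hmin (gradient f x - y)
  rw [← inner_sub_left, inner_self_eq_zero] at this
  exact sub_eq_zero.1 this

end StrongConvexity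

/-! ### Feasibility, integrability and the Lagrangian -/

section Duality

variable {p d m : ℕ} {J : Vec p → ℝ} {g : Fin m → Vec p → Vec d → ℝ} {K : Set (Vec d)}
  {ν : Measure (Vec d)} {s G lam : Vec d → Vec m}

theorem StandingAssumptions.value_le (hJg : StandingAssumptions J g K ν) {s : Vec d → Vec m}
    {z : Vec p} (hz : z ∈ feasible g K s) : value J g K s ≤ J z := by
  obtain ⟨c, hc0, hc⟩ := hJg.strongly_convex
  obtain ⟨b, hb⟩ :=
    StrongConvexOn.exists_forall_ge hc (hJg.contDiff.differentiable one_ne_zero) hc0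
  exact csInf_le ⟨b, by rintro _ ⟨x, -, rfl⟩; exact hb x⟩ (mem_image_of_mem J hz)

theorem le_value {a : ℝ} (hne : (feasible g K s).Nonempty) (h : ∀ z ∈ feasible g K s, a ≤ J z) :
    a ≤ value J g K s :=
  le_csInf (hne.image J) (by rintro _ ⟨z, hz, rfl⟩; exact h z hz)

theorem StandingAssumptions.continuousOn (hJg : StandingAssumptions J g K ν) (i : Fin m)
    (z : Vec p) : ContinuousOn (g i z) K :=
  (hJg.contDiffOn i).continuousOn.comp (f := fun ξ : Vec d => (z, ξ)) (by fun_prop)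
    fun _ hξ => ⟨mem_univ _, hξ⟩

theorem StandingAssumptions.exists_bound (hJg : StandingAssumptions J g K ν) (hK : IsCompact K)
    (z : Vec p) : ∃ B : ℝ, 0 ≤ B ∧ ∀ i, ∀ ξ ∈ K, |g i z ξ| ≤ B := by
  choose B hB using fun i => hK.exists_bound_of_continuousOn (hJg.continuousOn i z)
  refine ⟨∑ i, |B i|, by positivity, fun i ξ hξ => (hB i ξ hξ).trans ((le_abs_self _).trans ?_)⟩
  exact Finset.single_le_sum (f := fun i => |B i|) (fun _ _ => abs_nonneg _) (Finset.mem_univ i)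

/-- Compactness turns the strict Slater inequality into a uniform margin. -/
theorem exists_pos_forall_le_neg (hJg : StandingAssumptions J g K ν) (hK : IsCompact K)
    {z : Vec p} (hz : ∀ ξ ∈ K, ∀ i, g i z ξ < 0) :
    ∃ ε : ℝ, 0 < ε ∧ ∀ ξ ∈ K, ∀ i, g i z ξ ≤ -ε := by
  have h1 : ∀ i, ∃ ε : ℝ, 0 < ε ∧ ∀ ξ ∈ K, g i z ξ ≤ -ε := by
    intro i
    rcases K.eq_empty_or_nonempty with rfl | hne
    · exact ⟨1, one_pos, by simp⟩
    · obtain ⟨x, hx, hmax⟩ := hK.exists_isMaxOn hne (hJg.continuousOn i z)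
      exact ⟨-g i z x, by linarith [hz x hx i], fun ξ hξ => by simpa using hmax hξ⟩
  choose ε hε0 hε using h1
  rcases isEmpty_or_nonempty (Fin m) with hm | hm
  · exact ⟨1, one_pos, fun _ _ i => (hm.false i).elim⟩
  · obtain ⟨j, hj⟩ := Finite.exists_min ε
    exact ⟨ε j, hε0 j, fun ξ hξ i => (hε i ξ hξ).trans (by linarith [hj i])⟩

theorem feasible_nonempty (hslater : Slater g K) (hs : IsSlack K ν s) :
    (feasible g K s).Nonempty := by
  obtain ⟨z, hz⟩ := hslater
  exact ⟨z, fun ξ hξ i => (hz ξ hξ i).le.trans (hs.2 ξ hξ i)⟩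

theorem memLp_apply {u : Vec d → Vec m} (hu : MemLp u 2 (ν.restrict K)) (i : Fin m) :
    MemLp (fun ξ => u ξ i) 2 (ν.restrict K) :=
  (EuclideanSpace.proj (𝕜 := ℝ) i).comp_memLp' hu

theorem MemLp.integrable_inner {u v : Vec d → Vec m} (hu : MemLp u 2 (ν.restrict K))
    (hv : MemLp v 2 (ν.restrict K)) : Integrable (fun ξ => inner ℝ (u ξ) (v ξ)) (ν.restrict K) := by
  simp only [PiLp.inner_apply]
  exact integrable_finsetSum _ fun i _ =>
    (memLp_apply hv i).integrable_mul (memLp_apply hu i)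

theorem aestronglyMeasurable_toLp {v : Vec d → Fin m → ℝ}
    (hv : ∀ i, AEStronglyMeasurable (fun ξ => v ξ i) (ν.restrict K)) :
    AEStronglyMeasurable (fun ξ => (WithLp.toLp 2 (v ξ) : Vec m)) (ν.restrict K) := by
  have h1 : AEStronglyMeasurable v (ν.restrict K) :=
    (aemeasurable_pi_lambda _ fun i => (hv i).aemeasurable).aestronglyMeasurable
  exact (PiLp.continuous_toLp 2 _).comp_aestronglyMeasurable h1

theorem norm_le_of_forall_abs_le {x : Vec m} {C : ℝ} (hC : ∀ i, |x i| ≤ C) :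
    ‖x‖ ≤ ∑ _i : Fin m, C := by
  have h1 : x = ∑ i, x i • EuclideanSpace.single i (1 : ℝ) := by
    ext j
    simp [Finset.sum_apply, Pi.single_apply]
  rw [h1]
  refine (norm_sum_le _ _).trans (Finset.sum_le_sum fun i _ => ?_)
  simpa [norm_smul] using hC i

theorem memLp_of_bounded [IsFiniteMeasure (ν.restrict K)] (hK : MeasurableSet K)
    {v : Vec d → Vec m} (hv : AEStronglyMeasurable v (ν.restrict K))
    (hb : ∃ C : ℝ, ∀ ξ ∈ K, ‖v ξ‖ ≤ C) : MemLp v 2 (ν.restrict K) := by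
  obtain ⟨C, hC⟩ := hb
  exact MemLp.of_bound hv C ((ae_restrict_iff' hK).2 (Eventually.of_forall hC))

theorem inner_eq_sum_mul (x y : Vec m) : inner ℝ x y = ∑ i, x i * y i := by
  simp [PiLp.inner_apply, mul_comm]

/-- The requirements at `z` as a vector-valued function of the disturbance. -/
def requirements (g : Fin m → Vec p → Vec d → ℝ) (z : Vec p) (ξ : Vec d) : Vec m :=
  WithLp.toLp 2 fun i => g i z ξ

theorem memLp_requirements [IsFiniteMeasure (ν.restrict K)] (hJg : StandingAssumptions J g K ν)
    (hK : IsCompact K) (z : Vec p) : MemLp (requirements g z) 2 (ν.restrict K) := by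
  obtain ⟨B, -, hB⟩ := hJg.exists_bound hK z
  refine memLp_of_bounded hK.measurableSet
    (aestronglyMeasurable_toLp fun i => (hJg.memLp i z).aestronglyMeasurable)
    ⟨_, fun ξ hξ => norm_le_of_forall_abs_le fun i => hB i ξ hξ⟩

theorem lagrangian_eq (z : Vec p) (lam s : Vec d → Vec m) :
    lagrangian J g K ν z lam s =
      J z + ∫ ξ in K, inner ℝ (lam ξ) (requirements g z ξ - s ξ) ∂ν := by
  simp [lagrangian, inner_eq_sum_mul, requirements]

/-- Weak duality at a single point. -/
theorem lagrangian_le [IsFiniteMeasure (ν.restrict K)] (hK : IsCompact K)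
    (hlam : IsDualVariable K ν lam) {z : Vec p} (hz : z ∈ feasible g K s) :
    lagrangian J g K ν z lam s ≤ J z := by
  have : ∫ ξ in K, ∑ i, lam ξ i * (g i z ξ - s ξ i) ∂ν ≤ 0 := by
    refine integral_nonpos_of_ae ?_
    filter_upwards [hlam.2, ae_restrict_mem hK.measurableSet] with ξ h1 h2
    exact Finset.sum_nonpos fun i _ =>
      mul_nonpos_of_nonneg_of_nonpos (h1 i) (by linarith [hz ξ h2 i])
  unfold lagrangian
  linarith

/-- The Lagrangian is affine in the slacks. -/
theorem lagrangian_add [IsFiniteMeasure (ν.restrict K)] (hJg : StandingAssumptions J g K ν)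
    (hK : IsCompact K) (hlam : MemLp lam 2 (ν.restrict K)) (hs : MemLp s 2 (ν.restrict K))
    {v : Vec d → Vec m} (hv : MemLp v 2 (ν.restrict K)) (z : Vec p) :
    lagrangian J g K ν z lam (s + v) =
      lagrangian J g K ν z lam s - ∫ ξ in K, inner ℝ (lam ξ) (v ξ) ∂ν := by
  have h1 : Integrable (fun ξ => inner ℝ (lam ξ) (requirements g z ξ - s ξ)) (ν.restrict K) :=
    MemLp.integrable_inner hlam ((memLp_requirements hJg hK z).sub hs)
  rw [lagrangian_eq, lagrangian_eq, add_sub_assoc,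
    ← integral_sub h1 (MemLp.integrable_inner hlam hv)]
  congr 2
  ext ξ
  rw [← inner_sub_right, Pi.add_apply, sub_sub]

/-! ### Subgradients as multipliers -/

/-- `G` satisfies the subgradient inequality for the optimal value at `s` in all bounded
directions. -/
def HasBoundedSubgradient (J : Vec p → ℝ) (g : Fin m → Vec p → Vec d → ℝ) (K : Set (Vec d))
    (ν : Measure (Vec d)) (s G : Vec d → Vec m) : Prop :=
  ∀ v : Vec d → Vec m, AEStronglyMeasurable v (ν.restrict K) → (∃ C : ℝ, ∀ ξ ∈ K, ‖v ξ‖ ≤ C) →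
    ∀ z ∈ feasible g K (s + v), value J g K s + ∫ ξ in K, inner ℝ (G ξ) (v ξ) ∂ν ≤ J z

theorem HasValueSubgradient.hasBoundedSubgradient [IsFiniteMeasure (ν.restrict K)]
    (hJg : StandingAssumptions J g K ν) (hK : IsCompact K) (hs : IsSlack K ν s)
    (hG : HasValueSubgradient J g K ν s G) : HasBoundedSubgradient J g K ν s G := by
  intro v hv hb z hz
  have := hG.2 (s + v) (hs.1.add (memLp_of_bounded hK.measurableSet hv hb)) ⟨z, hz⟩
  simp only [Pi.add_apply, add_sub_cancel_left] at this
  exact this.trans (hJg.value_le hz)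

/-- Mixing `y` feasible for `s` with `z` feasible for `s + v` gives a point feasible for `s + t •
v`. Hence the value there is at most `(1 - t) * value s + t * J z`; compare slopes at `0`. -/
theorem HasValueGradient.hasBoundedSubgradient (hJg : StandingAssumptions J g K ν)
    (hne : (feasible g K s).Nonempty) (hG : HasValueGradient J g K ν s G) :
    HasBoundedSubgradient J g K ν s G := by
  intro v hv hb z hz
  obtain ⟨c, hc0, hc⟩ := hJg.strongly_convex
  have hconv : ConvexOn ℝ univ J := (hc.strictConvexOn hc0).convexOn
  have key := hasDerivAt_le_of_forall_le (a := J z - value J g K s) (hG.2 v hv hb) ?_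
  · linarith
  intro t ht
  have h1t : 0 < 1 - t := by linarith [ht.2]
  simp only [zero_smul, add_zero]
  -- Isolating `value s` lets the infimum over `y` be taken last.
  have h2 : (value J g K (s + t • v) - t * J z) / (1 - t) ≤ value J g K s := by
    refine le_value hne fun y hy => ?_
    rw [div_le_iff₀ h1t]
    have h3 := hconv.2 (mem_univ y) (mem_univ z) h1t.le ht.1.le (by ring)
    have h4 : (1 - t) • y + t • z ∈ feasible g K (s + t • v) := by
      intro ξ hξ i
      have h5 := (hJg.convex i ξ hξ).2 (mem_univ y) (mem_univ z) h1t.le ht.1.le (by ring)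
      have h6 := mul_le_mul_of_nonneg_left (hy ξ hξ i) h1t.le
      have h7 := mul_le_mul_of_nonneg_left (hz ξ hξ i) ht.1.le
      simp only [smul_eq_mul, Pi.add_apply, PiLp.add_apply, Pi.smul_apply, PiLp.smul_apply]
        at h5 h7 ⊢
      linarith
    have h8 := hJg.value_le h4
    simp only [smul_eq_mul] at h3
    linarith
  rw [div_le_iff₀ h1t] at h2
  linarith

/-- The direction along coordinate `i` supported on `A`. -/
noncomputable def indicatorDirection (A : Set (Vec d)) (i : Fin m) : Vec d → Vec m :=
  A.indicator fun _ => EuclideanSpace.single i 1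

theorem aestronglyMeasurable_indicatorDirection {A : Set (Vec d)} (hA : MeasurableSet A)
    (i : Fin m) : AEStronglyMeasurable (indicatorDirection A i) (ν.restrict K) :=
  (stronglyMeasurable_const.indicator hA).aestronglyMeasurable

theorem norm_indicatorDirection_le (A : Set (Vec d)) (i : Fin m) (ξ : Vec d) :
    ‖indicatorDirection A i ξ‖ ≤ 1 :=
  (norm_indicator_le_norm_self _ _).trans (by simp)

theorem integral_inner_indicatorDirection {A : Set (Vec d)} (hA : MeasurableSet A) (i : Fin m) :
    ∫ ξ in K, inner ℝ (G ξ) (indicatorDirection A i ξ) ∂ν =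
      ∫ ξ in A, G ξ i ∂(ν.restrict K) := by
  rw [← integral_indicator hA]
  congr 1
  ext ξ
  by_cases hξ : ξ ∈ A <;> simp [indicatorDirection, hξ, EuclideanSpace.inner_single_right]

/-- Raising one slack on a set `A` keeps feasible points feasible, so the integral of `G ξ i` over
`A` is at most `0`. -/
theorem HasBoundedSubgradient.isDualVariable_neg [IsFiniteMeasure (ν.restrict K)]
    (hG : HasBoundedSubgradient J g K ν s G) (hGL : MemLp G 2 (ν.restrict K))
    (hne : (feasible g K s).Nonempty) : IsDualVariable K ν (-G) := by
  refine ⟨hGL.neg, ae_all_iff.2 fun i => ?_⟩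
  have hint : Integrable (fun ξ => G ξ i) (ν.restrict K) :=
    (memLp_apply hGL i).integrable one_le_two
  refine ae_nonneg_of_forall_setIntegral_nonneg hint.neg fun A hA _ => ?_
  have h1 : value J g K s + ∫ ξ in A, G ξ i ∂(ν.restrict K) ≤ value J g K s := by
    refine le_value hne fun z hz => ?_
    rw [← integral_inner_indicatorDirection hA]
    refine hG _ (aestronglyMeasurable_indicatorDirection hA i)
      ⟨1, fun ξ _ => norm_indicatorDirection_le A i ξ⟩ z fun ξ hξ j => (hz ξ hξ j).trans ?_
    have : 0 ≤ indicatorDirection A i ξ j := by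
      by_cases hξA : ξ ∈ A
      · by_cases hij : j = i <;> simp [indicatorDirection, hξA, hij]
      · simp [indicatorDirection, hξA]
    simpa using this
  simp only [Pi.neg_apply, PiLp.neg_apply, integral_neg]
  linarith

/-- The constraint violation at `z`, truncated from below. -/
def truncatedViolation (g : Fin m → Vec p → Vec d → ℝ) (s : Vec d → Vec m) (z : Vec p) (n : ℕ)
    (ξ : Vec d) : Vec m :=
  WithLp.toLp 2 fun i => max (g i z ξ - s ξ i) (-n)

/-- The direction `g z - s` is bounded above on `K`, but perhaps not below, as `s` is only
square-integrable. Truncating at `-n` only enlarges the slacks, so `z` stays feasible; dominated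
convergence removes the truncation. -/
theorem HasBoundedSubgradient.value_le_lagrangian_neg [IsFiniteMeasure (ν.restrict K)]
    (hJg : StandingAssumptions J g K ν) (hK : IsCompact K) (hs : IsSlack K ν s)
    (hG : HasBoundedSubgradient J g K ν s G) (hGL : MemLp G 2 (ν.restrict K)) (z : Vec p) :
    value J g K s ≤ lagrangian J g K ν z (-G) s := by
  obtain ⟨B, hB0, hB⟩ := hJg.exists_bound hK z
  have hmeas : ∀ n, AEStronglyMeasurable (truncatedViolation g s z n) (ν.restrict K) := fun n =>
    aestronglyMeasurable_toLp fun i => by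
      have h1 := ((hJg.memLp i z).aestronglyMeasurable.sub
        (memLp_apply hs.1 i).aestronglyMeasurable)
      exact h1.sup aestronglyMeasurable_const
  have hle : ∀ n : ℕ, value J g K s + ∫ ξ in K, inner ℝ (G ξ) (truncatedViolation g s z n ξ) ∂ν
      ≤ J z := by
    intro n
    refine hG _ (hmeas n) ⟨_, fun ξ hξ => norm_le_of_forall_abs_le (C := B + n) fun i => ?_⟩ z ?_
    · have h1 := (le_abs_self _).trans (hB i ξ hξ)
      have h2 := hs.2 ξ hξ i
      have h3 : (0 : ℝ) ≤ n := n.cast_nonneg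
      exact abs_le.2 ⟨le_max_of_le_right (by linarith), max_le (by linarith) (by linarith)⟩
    · intro ξ hξ i
      have := le_max_left (g i z ξ - s ξ i) (-n)
      simp only [Pi.add_apply, PiLp.add_apply, truncatedViolation]
      linarith
  have hw : MemLp (fun ξ => requirements g z ξ - s ξ) 2 (ν.restrict K) :=
    (memLp_requirements hJg hK z).sub hs.1
  have hlim : Tendsto (fun n : ℕ => ∫ ξ in K, inner ℝ (G ξ) (truncatedViolation g s z n ξ) ∂ν)
      atTop (𝓝 (∫ ξ in K, inner ℝ (G ξ) (requirements g z ξ - s ξ) ∂ν)) := by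
    refine tendsto_integral_of_dominated_convergence
      (fun ξ => ‖G ξ‖ * ‖requirements g z ξ - s ξ‖)
      (fun n => hGL.aestronglyMeasurable.inner (hmeas n))
      (hGL.norm.integrable_mul hw.norm) (fun n => Eventually.of_forall fun ξ => ?_)
      (Eventually.of_forall fun ξ => ?_)
    · refine (norm_inner_le_norm _ _).trans (mul_le_mul_of_nonneg_left ?_ (norm_nonneg _))
      rw [EuclideanSpace.norm_eq, EuclideanSpace.norm_eq]
      refine Real.sqrt_le_sqrt (Finset.sum_le_sum fun i _ => ?_)
      simp only [truncatedViolation, requirements, PiLp.sub_apply, Real.norm_eq_abs]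
      refine pow_le_pow_left₀ (abs_nonneg _) ?_ 2
      have h3 : (0 : ℝ) ≤ n := n.cast_nonneg
      rcases le_total (g i z ξ - s ξ i) (-n) with h | h
      · rw [max_eq_right h, abs_of_nonpos (by linarith), abs_of_nonpos (by linarith)]
        linarith
      · rw [max_eq_left h]
    · refine tendsto_const_nhds.congr' ?_
      have h1 : ∀ᶠ n : ℕ in atTop, ∀ i, -(g i z ξ - s ξ i) ≤ n :=
        eventually_all.2 fun i => tendsto_natCast_atTop_atTop.eventually_ge_atTop _
      filter_upwards [h1] with n hn
      congr 1
      ext i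
      simp only [truncatedViolation, requirements, PiLp.sub_apply]
      rw [max_eq_left (by linarith [hn i])]
  have h2 := le_of_tendsto' (hlim.const_add (value J g K s)) hle
  rw [lagrangian_eq]
  simp only [Pi.neg_apply, inner_neg_left, integral_neg]
  linarith

/-! ### Strong duality and uniqueness of the dual solution -/

theorem coe_value_le_dualFunction (h : ∀ z, value J g K s ≤ lagrangian J g K ν z lam s) :
    (value J g K s : EReal) ≤ dualFunction J g K ν lam s :=
  le_iInf fun z => EReal.coe_le_coe_iff.2 (h z)

/-- Weak duality. -/
theorem dualFunction_le_coe_value [IsFiniteMeasure (ν.restrict K)] (hK : IsCompact K)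
    (hne : (feasible g K s).Nonempty) (hlam : IsDualVariable K ν lam) :
    dualFunction J g K ν lam s ≤ (value J g K s : EReal) := by
  have h1 : ∀ z ∈ feasible g K s, dualFunction J g K ν lam s ≤ (J z : EReal) := fun z hz =>
    (iInf_le _ z).trans (EReal.coe_le_coe_iff.2 (lagrangian_le hK hlam hz))
  obtain ⟨z₀, hz₀⟩ := hne
  induction hD : dualFunction J g K ν lam s with
  | bot => exact bot_le
  | top => simp [hD] at h1; exact (h1 z₀ hz₀).elim
  | coe a =>
    refine EReal.coe_le_coe_iff.2 (le_value ⟨z₀, hz₀⟩ fun z hz => ?_)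
    have := h1 z hz
    rwa [hD, EReal.coe_le_coe_iff] at this

theorem HasBoundedSubgradient.isDualSolution_neg [IsFiniteMeasure (ν.restrict K)]
    (hJg : StandingAssumptions J g K ν) (hK : IsCompact K) (hslater : Slater g K)
    (hs : IsSlack K ν s) (hG : HasBoundedSubgradient J g K ν s G)
    (hGL : MemLp G 2 (ν.restrict K)) : IsDualSolution J g K ν s (-G) :=
  have hne := feasible_nonempty hslater hs
  ⟨hG.isDualVariable_neg hGL hne, fun _ hmu => (dualFunction_le_coe_value hK hne hmu).trans
    (coe_value_le_dualFunction (hG.value_le_lagrangian_neg hJg hK hs hGL))⟩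

/-- The Slater margin absorbs small bounded perturbations, so `value` near `s` is never the default
`sInf ∅ = 0`. -/
theorem eventually_feasible_nonempty (hJg : StandingAssumptions J g K ν) (hK : IsCompact K)
    (hslater : Slater g K) (hs : IsSlack K ν s) {v : Vec d → Vec m}
    (hb : ∃ C : ℝ, ∀ ξ ∈ K, ‖v ξ‖ ≤ C) :
    ∀ᶠ t : ℝ in 𝓝 0, (feasible g K (s + t • v)).Nonempty := by
  obtain ⟨z, hz⟩ := hslater
  obtain ⟨C, hC⟩ := hb
  obtain ⟨ε, hε0, hε⟩ := exists_pos_forall_le_neg hJg hK hz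
  have h1 : Tendsto (fun t : ℝ => |t| * C) (𝓝 0) (𝓝 0) := by
    have : Continuous fun t : ℝ => |t| * C := by fun_prop
    simpa using this.tendsto 0
  filter_upwards [h1.eventually_lt_const hε0] with t ht
  refine ⟨z, fun ξ hξ i => (hε ξ hξ i).trans ?_⟩
  have h2 : |t * v ξ i| ≤ |t| * C := by
    rw [abs_mul]
    exact mul_le_mul_of_nonneg_left ((PiLp.norm_apply_le (v ξ) i).trans (hC ξ hξ)) (abs_nonneg t)
  have h3 := neg_le_of_abs_le h2
  have h4 := hs.2 ξ hξ i
  simp only [Pi.add_apply, PiLp.add_apply, Pi.smul_apply, PiLp.smul_apply, smul_eq_mul]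
  linarith

/-- Where the optimal value has a gradient, its negative is the only dual solution. -/
theorem HasValueGradient.ae_eq_neg_of_isDualSolution [IsFiniteMeasure (ν.restrict K)]
    (hJg : StandingAssumptions J g K ν) (hK : IsCompact K) (hslater : Slater g K)
    (hs : IsSlack K ν s) (hG : HasValueGradient J g K ν s G)
    (hlam : IsDualSolution J g K ν s lam) : ∀ᵐ ξ ∂(ν.restrict K), lam ξ = -G ξ := by
  have hne := feasible_nonempty hslater hs
  have hsub := hG.hasBoundedSubgradient hJg hne
  -- No gap at `lam`: it does at least as well as `-G`, which attains the optimal value.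
  have hlow : ∀ z, value J g K s ≤ lagrangian J g K ν z lam s := fun z => by
    have h1 := (coe_value_le_dualFunction (hsub.value_le_lagrangian_neg hJg hK hs hG.1)).trans
      (hlam.2 _ (hsub.isDualVariable_neg hG.1 hne))
    exact EReal.coe_le_coe_iff.1 (h1.trans (iInf_le _ z))
  have hint : ∀ v : Vec d → Vec m, AEStronglyMeasurable v (ν.restrict K) →
      (∃ C : ℝ, ∀ ξ ∈ K, ‖v ξ‖ ≤ C) →
      ∫ ξ in K, inner ℝ (lam ξ) (v ξ) ∂ν = -∫ ξ in K, inner ℝ (G ξ) (v ξ) ∂ν := by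
    intro v hv hb
    have hvL := memLp_of_bounded hK.measurableSet hv hb
    have hd := (hG.2 v hv hb).add
      ((hasDerivAt_id (0 : ℝ)).mul_const (∫ ξ in K, inner ℝ (lam ξ) (v ξ) ∂ν))
    -- Weak duality at `s + t • v`, with `hlow`, makes `t = 0` a local minimum of `value (s + t • v)
    -- + t * ∫ ⟨lam, v⟩`.
    have hzero := IsLocalMin.hasDerivAt_eq_zero ?_ hd
    · linarith
    filter_upwards [eventually_feasible_nonempty hJg hK hslater hs hb] with t ht
    simp only [Pi.add_apply, zero_smul, add_zero, id, zero_mul, ← sub_le_iff_le_add]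
    refine le_value ht fun z hz => ?_
    have h1 := lagrangian_le (J := J) hK hlam.1 hz
    rw [lagrangian_add hJg hK hlam.1.1 hs.1 (hvL.const_smul t)] at h1
    simp only [Pi.smul_apply, inner_smul_right, integral_const_mul] at h1
    linarith [hlow z]
  have hcoord : ∀ i, (fun ξ => lam ξ i) =ᵐ[ν.restrict K] fun ξ => -G ξ i := by
    intro i
    refine Integrable.ae_eq_of_forall_setIntegral_eq _ _
      ((memLp_apply hlam.1.1 i).integrable one_le_two)
      ((memLp_apply hG.1 i).integrable one_le_two).neg fun A hA _ => ?_
    rw [integral_neg, ← integral_inner_indicatorDirection hA,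
      ← integral_inner_indicatorDirection hA]
    exact hint _ (aestronglyMeasurable_indicatorDirection hA i)
      ⟨1, fun ξ _ => norm_indicatorDirection_le A i ξ⟩
  filter_upwards [ae_all_iff.2 hcoord] with ξ hξ
  ext i
  simpa using hξ i

theorem fixedPointRelation_of_ae_eq {P : Measure (Vec d)} {h : Vec m → ℝ}
    (hinj : Function.Injective (gradient h))
    (hlam : ∀ᵐ ξ ∂(ν.restrict K), lam ξ = density P ν ξ • gradient h (s ξ)) :
    FixedPointRelation K ν P h s lam := by
  filter_upwards [hlam] with ξ hξ hpos
  rw [hξ, inv_smul_smul₀ hpos.ne', Function.leftInverse_invFun hinj]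

end Duality

end Resilient

theorem proposition5 {p d m : ℕ}
    (K : Set (Resilient.Vec d)) (hK : IsCompact K)
    (ν : MeasureTheory.Measure (Resilient.Vec d)) [MeasureTheory.IsLocallyFiniteMeasure ν]
    (P : MeasureTheory.Measure (Resilient.Vec d)) [MeasureTheory.IsProbabilityMeasure P]
    (hPK : P K = 1) (hPν : P.AbsolutelyContinuous ν)
    (J : Resilient.Vec p → ℝ) (g : Fin m → Resilient.Vec p → Resilient.Vec d → ℝ)
    (hJg : Resilient.StandingAssumptions J g K ν) (hslater : Resilient.Slater g K)
    (h : Resilient.Vec m → ℝ) (hh : Resilient.IsViolationCost h)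
    (s : Resilient.Vec d → Resilient.Vec m) :
    Function.Bijective (gradient h) ∧
    (Resilient.IsResilientEquilibrium J g K ν P h s →
      ∀ lam : Resilient.Vec d → Resilient.Vec m, Resilient.IsDualSolution J g K ν s lam →
        Resilient.FixedPointRelation K ν P h s lam) ∧
    (Resilient.IsGeneralizedResilientEquilibrium J g K ν P h s →
      ∃ lam : Resilient.Vec d → Resilient.Vec m, Resilient.IsDualSolution J g K ν s lam ∧
        Resilient.FixedPointRelation K ν P h s lam) := by
  obtain ⟨c, hc0, hc⟩ := hh.strongly_convex
  have hinj := Resilient.StrongConvexOn.injective_gradient hc hh.differentiable hc0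
  -- Finiteness on `K` makes bounded measurable directions square-integrable and `L²` functions
  -- integrable.
  have : MeasureTheory.IsFiniteMeasure (ν.restrict K) := ⟨by simpa using hK.measure_lt_top⟩
  refine ⟨⟨hinj, Resilient.StrongConvexOn.surjective_gradient hc hh.differentiable hc0⟩,
    fun hs lam hlam => ?_, fun hs => ?_⟩
  · refine Resilient.fixedPointRelation_of_ae_eq hinj ?_
    simpa using hs.2.ae_eq_neg_of_isDualSolution hJg hK hslater hs.1 hlam
  · refine ⟨_, (hs.2.hasBoundedSubgradient hJg hK hs.1).isDualSolution_neg hJg hK hslater hs.1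
      hs.2.1, Resilient.fixedPointRelation_of_ae_eq hinj ?_⟩
    exact Filter.Eventually.of_forall fun ξ => by simp
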